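/- Let $G=(A,\Phi)$ be a compact quantum group: $A\neq 0$ is a unital $C^*$-algebra and $\Phi:A\to A\otimes A$ (minimal tensor product) is a coassociative unital $*$-homomorphism such that $(A\otimes 1)\Phi(A)$ and $(1\otimes A)\Phi(A)$ span dense subspaces of $A\otimes A$. Let $\widehat G$ be the set of equivalence classes of irreducible finite-dimensional unitary representations of $G$. For $a,b\in\widehat G$ let $a\times b\subseteq\widehat G$ be the set of classes of the irreducible subrepresentations of $u^a\otimes u^b$, where $u^a, u^b$ represent $a,b$, and let $\bar b$ be the conjugate class of $b$. For $S,T\subseteq\widehat G$ put $S\times T=\bigcup_{a\in S,\,b\in T}a\times b$. A subobject of $\widehat G$ is a subset $\Sigma\subseteq\widehat G$ that contains the trivial class and is closed under $\times$ and conjugation. Its $\Sigma$-cosets are the classes of the relation $a\sim b\iff (a\times\bar b)\cap\Sigma\neq\emptyset$. The subobject $\Sigma$ is called central if the $\Sigma$-cosets form a group under the product $(C,D)\mapsto C\times D$ of subsets. The center subobject $\widetilde\Sigma_G$ is the intersection of all central subobjects of $\widehat G$, and the center of $G$ is (as a discrete group) the set $Z(G)=\widehat G/\widetilde\Sigma_G$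 of $\widetilde\Sigma_G$-cosets, with the product of cosets as its multiplication. **Theorem.** Compact quantum groups with identical fusion rules have isomorphic centers. More precisely, let $G_1,G_2$ be compact quantum groups and let $p:\widehat{G_1}\to\widehat{G_2}$ be a bijection with $p(a\times b)=p(a)\times p(b)$ (as subsets of $\widehat{G_2}$) for all $a,b\in\widehat{G_1}$. Then: 1. a subset $\Sigma\subseteq\widehat{G_1}$ is a central subobject of $\widehat{G_1}$ if and only if $p(\Sigma)$ is a central subobject of $\widehat{G_2}$; 2. $p(\widetilde\Sigma_{G_1})=\widetilde\Sigma_{G_2}$; 3. $C\mapsto p(C)$ is a bijection from the set of $\widetilde\Sigma_{G_1}$-cosets onto the set of $\widetilde\Sigma_{G_2}$-cosets such that $E=C\times D$ if and only if $p(E)=p(C)\times p(D)$, for all $\widetilde\Sigma_{G_1}$-cosets $C,D,E$; that is, it is an isomorphism of groups $Z(G_1)\cong Z(G_2)$. -/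

import Mathlib

open scoped TensorProduct InnerProductSpace

universe u v

namespace CQG

section TensorRep

variable {A B : Type u} [CStarAlgebra A] [CStarAlgebra B]
  {H K : Type u} [NormedAddCommGroup H] [InnerProductSpace ℂ H] [CompleteSpace H]
  [NormedAddCommGroup K] [InnerProductSpace ℂ K] [CompleteSpace K]

/-- A representation by bounded operators, as an algebra map into all linear operators. -/
noncomputable def opRep (π : A →⋆ₐ[ℂ] (H →L[ℂ] H)) : A →ₐ[ℂ] Module.End ℂ H where
  toFun a := (π a : H →ₗ[ℂ] H)
  map_one' := by ext; simp
  map_mul' a b := by ext; simp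
  map_zero' := by ext; simp
  map_add' a b := by ext; simp
  commutes' z := by ext; simp [Algebra.algebraMap_eq_smul_one]

/-- For representations `π` of `A` on `H` and `ρ` of `B` on `K`, the representation `π ⊗ ρ` of the
algebraic tensor product `A ⊗ B` on the (uncompleted) Hilbert space tensor product `H ⊗ K`. -/
noncomputable def tensorRep (π : A →⋆ₐ[ℂ] (H →L[ℂ] H)) (ρ : B →⋆ₐ[ℂ] (K →L[ℂ] K)) :
    A ⊗[ℂ] B →ₐ[ℂ] Module.End ℂ (H ⊗[ℂ] K) :=
  (Module.endTensorEndAlgHom (R := ℂ) (S := ℂ) (A := ℂ) (M := H) (N := K)).comp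
    (Algebra.TensorProduct.map
      (opRep π)
      (opRep ρ))

theorem tensorRep_tmul_tmul (π : A →⋆ₐ[ℂ] (H →L[ℂ] H)) (ρ : B →⋆ₐ[ℂ] (K →L[ℂ] K))
    (a : A) (b : B) (x : H) (y : K) :
    tensorRep π ρ (a ⊗ₜ b) (x ⊗ₜ y) = π a x ⊗ₜ ρ b y := rfl

theorem inner_tensorRep (π : A →⋆ₐ[ℂ] (H →L[ℂ] H)) (ρ : B →⋆ₐ[ℂ] (K →L[ℂ] K))
    (t : A ⊗[ℂ] B) (x y : H ⊗[ℂ] K) :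
    ⟪tensorRep π ρ t x, y⟫_ℂ = ⟪x, tensorRep π ρ (star t) y⟫_ℂ := by
  induction t with
  | zero => simp
  | add s t hs ht => simp [inner_add_left, inner_add_right, hs, ht]
  | tmul a b =>
    induction x with
    | zero => simp
    | add x₁ x₂ h₁ h₂ => simp only [map_add, inner_add_left, h₁, h₂]
    | tmul x₁ x₂ =>
      induction y with
      | zero => simp
      | add y₁ y₂ h₁ h₂ => simp only [map_add, inner_add_right, h₁, h₂]
      | tmul y₁ y₂ =>
        simp only [tensorRep_tmul_tmul, TensorProduct.star_tmul, TensorProduct.inner_tmul, map_star,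
          ContinuousLinearMap.star_eq_adjoint, ContinuousLinearMap.adjoint_inner_right]

theorem norm_tensorRep_sq (π : A →⋆ₐ[ℂ] (H →L[ℂ] H)) (ρ : B →⋆ₐ[ℂ] (K →L[ℂ] K))
    (t : A ⊗[ℂ] B) (x : H ⊗[ℂ] K) :
    ‖tensorRep π ρ t x‖ ^ 2 = RCLike.re ⟪x, tensorRep π ρ (star t * t) x⟫_ℂ := by
  rw [map_mul, Module.End.mul_apply, ← inner_tensorRep]
  exact (inner_self_eq_norm_sq (𝕜 := ℂ) _).symm

/-- If `star t * t + star r * r = c ^ 2`, then `π ⊗ ρ` maps `t` to an operator of norm at most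
`c`. -/
theorem norm_tensorRep_le_of_add (π : A →⋆ₐ[ℂ] (H →L[ℂ] H)) (ρ : B →⋆ₐ[ℂ] (K →L[ℂ] K))
    {t r : A ⊗[ℂ] B} {c : ℝ} (hc : 0 ≤ c)
    (h : star t * t + star r * r = ((c ^ 2 : ℝ) : ℂ) • (1 : A ⊗[ℂ] B)) (x : H ⊗[ℂ] K) :
    ‖tensorRep π ρ t x‖ ≤ c * ‖x‖ := by
  have h1 : ‖tensorRep π ρ t x‖ ^ 2 + ‖tensorRep π ρ r x‖ ^ 2 = c ^ 2 * ‖x‖ ^ 2 := by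
    have h2 : ⟪x, tensorRep π ρ (star t * t) x⟫_ℂ + ⟪x, tensorRep π ρ (star r * r) x⟫_ℂ =
        ((c ^ 2 : ℝ) : ℂ) * ⟪x, x⟫_ℂ := by
      refine (inner_add_right x _ _).symm.trans ?_
      rw [← LinearMap.add_apply, ← map_add, h, map_smul, map_one]
      exact inner_smul_right x x _
    rw [norm_tensorRep_sq, norm_tensorRep_sq, ← map_add, h2, RCLike.re_eq_complex_re,
      Complex.re_ofReal_mul]
    exact congrArg _ (inner_self_eq_norm_sq (𝕜 := ℂ) x)
  refine (pow_le_pow_iff_left₀ (by positivity) (by positivity) two_ne_zero).1 ?_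
  nlinarith [sq_nonneg ‖tensorRep π ρ r x‖]

theorem exists_add_star_mul_self (a : A) :
    ∃ r : A, star a * a + star r * r = ((‖a‖ ^ 2 : ℝ) : ℂ) • (1 : A) := by
  let _ := CStarAlgebra.spectralOrder A
  let _ := CStarAlgebra.spectralOrderedRing A
  have h : 0 ≤ algebraMap ℝ A (‖a‖ ^ 2) - star a * a :=
    sub_nonneg.2 CStarAlgebra.star_mul_le_algebraMap_norm_sq
  obtain ⟨r, hr⟩ := CStarAlgebra.nonneg_iff_eq_star_mul_self.1 h
  refine ⟨r, ?_⟩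
  rw [← hr, add_sub_cancel, Algebra.algebraMap_eq_smul_one, Complex.coe_smul]

theorem norm_tensorRep_tmul_le (π : A →⋆ₐ[ℂ] (H →L[ℂ] H)) (ρ : B →⋆ₐ[ℂ] (K →L[ℂ] K))
    (a : A) (b : B) (x : H ⊗[ℂ] K) : ‖tensorRep π ρ (a ⊗ₜ b) x‖ ≤ (‖a‖ * ‖b‖) * ‖x‖ := by
  have h1 (y : H ⊗[ℂ] K) : ‖tensorRep π ρ (a ⊗ₜ 1) y‖ ≤ ‖a‖ * ‖y‖ := by
    obtain ⟨r, hr⟩ := exists_add_star_mul_self a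
    refine norm_tensorRep_le_of_add (r := r ⊗ₜ 1) π ρ (norm_nonneg a) ?_ y
    simp only [TensorProduct.star_tmul, Algebra.TensorProduct.tmul_mul_tmul, star_one, mul_one,
      ← TensorProduct.add_tmul, hr, Algebra.TensorProduct.one_def, TensorProduct.smul_tmul']
  have h2 (y : H ⊗[ℂ] K) : ‖tensorRep π ρ (1 ⊗ₜ b) y‖ ≤ ‖b‖ * ‖y‖ := by
    obtain ⟨r, hr⟩ := exists_add_star_mul_self b
    refine norm_tensorRep_le_of_add (r := 1 ⊗ₜ r) π ρ (norm_nonneg b) ?_ y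
    simp only [TensorProduct.star_tmul, Algebra.TensorProduct.tmul_mul_tmul, star_one, mul_one,
      ← TensorProduct.tmul_add, hr, Algebra.TensorProduct.one_def, TensorProduct.tmul_smul]
  have h3 : a ⊗ₜ[ℂ] b = (a ⊗ₜ 1) * (1 ⊗ₜ b) := by simp
  rw [h3, map_mul, Module.End.mul_apply, mul_assoc]
  exact (h1 _).trans (by gcongr; exact h2 x)

theorem tensorRep_comp {A' B' : Type u} [CStarAlgebra A'] [CStarAlgebra B']
    (f : A' →⋆ₐ[ℂ] A) (g : B' →⋆ₐ[ℂ] B)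
    (π : A →⋆ₐ[ℂ] (H →L[ℂ] H)) (ρ : B →⋆ₐ[ℂ] (K →L[ℂ] K)) (t : A' ⊗[ℂ] B') :
    tensorRep π ρ (Algebra.TensorProduct.map (f : A' →ₐ[ℂ] A) (g : B' →ₐ[ℂ] B) t) =
      tensorRep (π.comp f) (ρ.comp g) t := by
  induction t with
  | zero => simp
  | add s t hs ht => simp [hs, ht]
  | tmul a b => rfl

end TensorRep

section MinNorm

variable {A B : Type u} [CStarAlgebra A] [CStarAlgebra B]

/-- The bound `c` dominates `‖(π ⊗ ρ)(t)‖` for all representations `π` of `A` and `ρ` of `B` on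
Hilbert spaces. -/
def IsTensorBound (t : A ⊗[ℂ] B) (c : ℝ) : Prop :=
  0 ≤ c ∧ ∀ (H K : Type u) [NormedAddCommGroup H] [InnerProductSpace ℂ H] [CompleteSpace H]
    [NormedAddCommGroup K] [InnerProductSpace ℂ K] [CompleteSpace K]
    (π : A →⋆ₐ[ℂ] (H →L[ℂ] H)) (ρ : B →⋆ₐ[ℂ] (K →L[ℂ] K)) (x : H ⊗[ℂ] K),
    ‖tensorRep π ρ t x‖ ≤ c * ‖x‖

/-- The minimal (spatial) C⋆-norm on the algebraic tensor product `A ⊗ B`: the supremum of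
`‖(π ⊗ ρ)(t)‖` over all representations `π` of `A` and `ρ` of `B` on Hilbert spaces. -/
noncomputable def minNorm (t : A ⊗[ℂ] B) : ℝ := sInf {c : ℝ | IsTensorBound t c}

theorem isTensorBound_tmul (a : A) (b : B) : IsTensorBound (a ⊗ₜ[ℂ] b) (‖a‖ * ‖b‖) :=
  ⟨by positivity, fun _ _ _ _ _ _ _ _ π ρ x => norm_tensorRep_tmul_le π ρ a b x⟩

theorem IsTensorBound.add {s t : A ⊗[ℂ] B} {c d : ℝ} (hs : IsTensorBound s c)
    (ht : IsTensorBound t d) : IsTensorBound (s + t) (c + d) := by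
  refine ⟨add_nonneg hs.1 ht.1, fun H K _ _ _ _ _ _ π ρ x => ?_⟩
  rw [map_add, LinearMap.add_apply, add_mul]
  exact (norm_add_le _ _).trans (add_le_add (hs.2 H K π ρ x) (ht.2 H K π ρ x))

theorem IsTensorBound.mul {s t : A ⊗[ℂ] B} {c d : ℝ} (hs : IsTensorBound s c)
    (ht : IsTensorBound t d) : IsTensorBound (s * t) (c * d) := by
  refine ⟨mul_nonneg hs.1 ht.1, fun H K _ _ _ _ _ _ π ρ x => ?_⟩
  rw [map_mul, Module.End.mul_apply, mul_assoc]
  exact (hs.2 H K π ρ _).trans (mul_le_mul_of_nonneg_left (ht.2 H K π ρ x) hs.1)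

theorem IsTensorBound.smul {t : A ⊗[ℂ] B} {c : ℝ} (ht : IsTensorBound t c) (z : ℂ) :
    IsTensorBound (z • t) (‖z‖ * c) := by
  refine ⟨mul_nonneg (norm_nonneg z) ht.1, fun H K _ _ _ _ _ _ π ρ x => ?_⟩
  rw [map_smul, LinearMap.smul_apply, norm_smul, mul_assoc]
  exact mul_le_mul_of_nonneg_left (ht.2 H K π ρ x) (norm_nonneg z)

theorem IsTensorBound.star {t : A ⊗[ℂ] B} {c : ℝ} (ht : IsTensorBound t c) :
    IsTensorBound (star t) c := by
  refine ⟨ht.1, fun H K _ _ _ _ _ _ π ρ x => ?_⟩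
  have h1 : ‖tensorRep π ρ (Star.star t) x‖ ^ 2 ≤
      ‖x‖ * (c * ‖tensorRep π ρ (Star.star t) x‖) := by
    rw [norm_tensorRep_sq, star_star, map_mul, Module.End.mul_apply]
    exact (re_inner_le_norm _ _).trans
      (mul_le_mul_of_nonneg_left (ht.2 H K π ρ _) (norm_nonneg _))
  have := ht.1
  by_contra! h
  nlinarith [mul_nonneg this (norm_nonneg x)]

theorem exists_isTensorBound (t : A ⊗[ℂ] B) : ∃ c, IsTensorBound t c := by
  induction t with
  | zero => exact ⟨0, le_rfl, fun H K _ _ _ _ _ _ π ρ x => by simp⟩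
  | tmul a b => exact ⟨_, isTensorBound_tmul a b⟩
  | add s t hs ht =>
    obtain ⟨c, hc⟩ := hs
    obtain ⟨d, hd⟩ := ht
    exact ⟨c + d, hc.add hd⟩

theorem bddBelow_isTensorBound (t : A ⊗[ℂ] B) : BddBelow {c : ℝ | IsTensorBound t c} :=
  ⟨0, fun _ hc => hc.1⟩

theorem minNorm_le {t : A ⊗[ℂ] B} {c : ℝ} (h : IsTensorBound t c) : minNorm t ≤ c :=
  csInf_le (bddBelow_isTensorBound t) h

theorem isTensorBound_minNorm (t : A ⊗[ℂ] B) : IsTensorBound t (minNorm t) := by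
  refine ⟨le_csInf (exists_isTensorBound t) fun c hc => hc.1,
    fun H K _ _ _ _ _ _ π ρ x => ?_⟩
  rcases (norm_nonneg x).eq_or_lt with hx | hx
  · obtain ⟨c, hc⟩ := exists_isTensorBound t
    simpa [← hx] using hc.2 H K π ρ x
  · rw [← div_le_iff₀ hx]
    exact le_csInf (exists_isTensorBound t) fun c hc => (div_le_iff₀ hx).2 (hc.2 H K π ρ x)

theorem minNorm_zero : minNorm (0 : A ⊗[ℂ] B) = 0 :=
  le_antisymm (minNorm_le ⟨le_rfl, fun H K _ _ _ _ _ _ π ρ x => by simp⟩)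
    (isTensorBound_minNorm _).1

theorem minNorm_neg (t : A ⊗[ℂ] B) : minNorm (-t) = minNorm t := by
  unfold minNorm IsTensorBound
  simp only [map_neg, LinearMap.neg_apply, norm_neg]

theorem minNorm_star_mul_self (t : A ⊗[ℂ] B) :
    minNorm t * minNorm t ≤ minNorm (star t * t) := by
  have h0 := (isTensorBound_minNorm (star t * t)).1
  have h : minNorm t ≤ Real.sqrt (minNorm (star t * t)) := by
    refine minNorm_le ⟨Real.sqrt_nonneg _, fun H K _ _ _ _ _ _ π ρ x => ?_⟩
    refine (pow_le_pow_iff_left₀ (by positivity) (by positivity) two_ne_zero).1 ?_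
    rw [mul_pow, Real.sq_sqrt h0, norm_tensorRep_sq]
    have := (re_inner_le_norm (𝕜 := ℂ) x (tensorRep π ρ (star t * t) x)).trans
      (mul_le_mul_of_nonneg_left ((isTensorBound_minNorm (star t * t)).2 H K π ρ x)
        (norm_nonneg x))
    nlinarith
  calc minNorm t * minNorm t ≤ _ := mul_self_le_mul_self (isTensorBound_minNorm t).1 h
    _ = _ := Real.mul_self_sqrt h0

end MinNorm

/-- The algebraic tensor product of two C⋆-algebras, as a type carrying the minimal C⋆-norm. -/
def PreMinTensor (A B : Type u) [CStarAlgebra A] [CStarAlgebra B] : Type u := A ⊗[ℂ] B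

namespace PreMinTensor

variable (A B : Type u) [CStarAlgebra A] [CStarAlgebra B]

noncomputable instance : Ring (PreMinTensor A B) := inferInstanceAs (Ring (A ⊗[ℂ] B))
noncomputable instance : StarRing (PreMinTensor A B) := inferInstanceAs (StarRing (A ⊗[ℂ] B))
noncomputable instance : Algebra ℂ (PreMinTensor A B) := inferInstanceAs (Algebra ℂ (A ⊗[ℂ] B))
noncomputable instance : StarModule ℂ (PreMinTensor A B) :=
  inferInstanceAs (StarModule ℂ (A ⊗[ℂ] B))

noncomputable instance : Norm (PreMinTensor A B) := ⟨fun t => minNorm (A := A) (B := B) t⟩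

noncomputable instance : SeminormedAddCommGroup (PreMinTensor A B) :=
  AddGroupSeminorm.toSeminormedAddCommGroup
    { toFun := fun t : PreMinTensor A B => minNorm (A := A) (B := B) t
      map_zero' := minNorm_zero
      add_le' := fun s t => minNorm_le ((isTensorBound_minNorm s).add (isTensorBound_minNorm t))
      neg' := minNorm_neg }

noncomputable instance : SeminormedRing (PreMinTensor A B) where
  __ := (inferInstance : SeminormedAddCommGroup (PreMinTensor A B))
  __ := (inferInstance : Ring (PreMinTensor A B))
  norm_mul_le s t := minNorm_le ((isTensorBound_minNorm (A := A) (B := B) s).mul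
    (isTensorBound_minNorm (A := A) (B := B) t))

noncomputable instance : NormedAlgebra ℂ (PreMinTensor A B) where
  norm_smul_le z t := minNorm_le ((isTensorBound_minNorm (A := A) (B := B) t).smul z)

instance : NormedStarGroup (PreMinTensor A B) where
  norm_star_le t := minNorm_le (isTensorBound_minNorm (A := A) (B := B) t).star

end PreMinTensor

/-- The minimal (spatial) tensor product `A ⊗ B` of two C⋆-algebras: the completion of the algebraic
tensor product in the minimal C⋆-norm. -/
def MinTensor (A B : Type u) [CStarAlgebra A] [CStarAlgebra B] : Type u :=
  UniformSpace.Completion (PreMinTensor A B)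

namespace MinTensor

open UniformSpace

section Structure

variable (A B : Type u) [CStarAlgebra A] [CStarAlgebra B]

noncomputable instance : NormedRing (MinTensor A B) :=
  inferInstanceAs (NormedRing (Completion (PreMinTensor A B)))
instance : CompleteSpace (MinTensor A B) :=
  inferInstanceAs (CompleteSpace (Completion (PreMinTensor A B)))
noncomputable instance : NormedAlgebra ℂ (MinTensor A B) where
  __ := (inferInstance : Algebra ℂ (Completion (PreMinTensor A B)))
  norm_smul_le := norm_smul_le (α := ℂ) (β := Completion (PreMinTensor A B))

variable {A B}

/-- The canonical map from the algebraic tensor product to the minimal tensor product. -/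
noncomputable def ofAlg (t : PreMinTensor A B) : MinTensor A B :=
  ((t : PreMinTensor A B) : Completion (PreMinTensor A B))

theorem continuous_ofAlg : Continuous (ofAlg : PreMinTensor A B → MinTensor A B) :=
  Completion.continuous_coe _

theorem denseRange_ofAlg : DenseRange (ofAlg : PreMinTensor A B → MinTensor A B) :=
  Completion.denseRange_coe

theorem norm_ofAlg (t : PreMinTensor A B) : ‖ofAlg t‖ = ‖t‖ := Completion.norm_coe t
theorem ofAlg_add (s t : PreMinTensor A B) : ofAlg (s + t) = ofAlg s + ofAlg t :=
  Completion.coe_add s t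
theorem ofAlg_mul (s t : PreMinTensor A B) : ofAlg (s * t) = ofAlg s * ofAlg t :=
  Completion.coe_mul s t
theorem ofAlg_one : ofAlg (1 : PreMinTensor A B) = 1 := rfl
theorem ofAlg_smul (z : ℂ) (t : PreMinTensor A B) : ofAlg (z • t) = z • ofAlg t :=
  Completion.coe_smul z t

theorem uniformContinuous_star_pre :
    UniformContinuous (star : PreMinTensor A B → PreMinTensor A B) :=
  uniformContinuous_of_continuousAt_zero (starAddEquiv : PreMinTensor A B ≃+ PreMinTensor A B)
    continuous_star.continuousAt

noncomputable instance : Star (MinTensor A B) := ⟨Completion.map (star : PreMinTensor A B → _)⟩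

theorem star_ofAlg (t : PreMinTensor A B) : star (ofAlg t) = ofAlg (star t) :=
  Completion.map_coe uniformContinuous_star_pre t

theorem continuous_star' : Continuous (star : MinTensor A B → MinTensor A B) :=
  Completion.continuous_map

theorem induction {p : MinTensor A B → Prop} (hp : IsClosed {x | p x})
    (h : ∀ t, p (ofAlg t)) (x : MinTensor A B) : p x :=
  Completion.induction_on x hp h

theorem induction₂ {p : MinTensor A B → MinTensor A B → Prop}
    (hp : IsClosed {x : MinTensor A B × MinTensor A B | p x.1 x.2})
    (h : ∀ s t, p (ofAlg s) (ofAlg t)) (x y : MinTensor A B) : p x y :=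
  Completion.induction_on₂ x y hp h

noncomputable instance : StarRing (MinTensor A B) where
  star_involutive x := by
    induction x using induction with
    | hp => exact isClosed_eq (continuous_star'.comp continuous_star') continuous_id
    | h t => rw [star_ofAlg, star_ofAlg, star_star]
  star_mul x y := by
    induction x, y using induction₂ with
    | hp => exact isClosed_eq (continuous_star'.comp continuous_mul)
              ((continuous_star'.comp continuous_snd).mul (continuous_star'.comp continuous_fst))
    | h s t => rw [← ofAlg_mul, star_ofAlg, star_ofAlg, star_ofAlg, star_mul, ofAlg_mul]
  star_add x y := by
    induction x, y using induction₂ with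
    | hp => exact isClosed_eq (continuous_star'.comp continuous_add)
              ((continuous_star'.comp continuous_fst).add (continuous_star'.comp continuous_snd))
    | h s t => rw [← ofAlg_add, star_ofAlg, star_ofAlg, star_ofAlg, star_add, ofAlg_add]

noncomputable instance : StarModule ℂ (MinTensor A B) where
  star_smul z x := by
    induction x using induction with
    | hp => exact isClosed_eq (continuous_star'.comp (continuous_const_smul z))
              (continuous_star'.const_smul (star z))
    | h t => rw [← ofAlg_smul, star_ofAlg, star_ofAlg, star_smul, ofAlg_smul]

instance : CStarRing (MinTensor A B) where
  norm_mul_self_le x := by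
    induction x using induction with
    | hp => exact isClosed_le (continuous_norm.mul continuous_norm)
              (continuous_norm.comp (continuous_star'.mul continuous_id))
    | h t =>
      rw [star_ofAlg, ← ofAlg_mul, norm_ofAlg, norm_ofAlg]
      exact minNorm_star_mul_self (A := A) (B := B) t

noncomputable instance : CStarAlgebra (MinTensor A B) where

/-- The elementary tensor `a ⊗ b` in the minimal tensor product. -/
noncomputable def tmul (a : A) (b : B) : MinTensor A B := ofAlg (a ⊗ₜ[ℂ] b : A ⊗[ℂ] B)

end Structure

section Map

variable {A B A' B' : Type u} [CStarAlgebra A] [CStarAlgebra B] [CStarAlgebra A'] [CStarAlgebra B']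

/-- The algebraic tensor product of two ⋆-homomorphisms. -/
noncomputable def preMap (f : A →⋆ₐ[ℂ] A') (g : B →⋆ₐ[ℂ] B') :
    PreMinTensor A B →ₐ[ℂ] PreMinTensor A' B' :=
  Algebra.TensorProduct.map (f : A →ₐ[ℂ] A') (g : B →ₐ[ℂ] B')

theorem preMap_star (f : A →⋆ₐ[ℂ] A') (g : B →⋆ₐ[ℂ] B') (t : PreMinTensor A B) :
    preMap f g (star t) = star (preMap f g t) := by
  change A ⊗[ℂ] B at t
  change Algebra.TensorProduct.map (f : A →ₐ[ℂ] A') (g : B →ₐ[ℂ] B') (star t) =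
    star (Algebra.TensorProduct.map (f : A →ₐ[ℂ] A') (g : B →ₐ[ℂ] B') t)
  induction t with
  | zero => simp
  | add s t hs ht => simp only [star_add, map_add, hs, ht]
  | tmul a b => simp [TensorProduct.star_tmul, map_star]

theorem norm_preMap_le (f : A →⋆ₐ[ℂ] A') (g : B →⋆ₐ[ℂ] B') (t : PreMinTensor A B) :
    ‖preMap f g t‖ ≤ ‖t‖ := by
  refine minNorm_le ⟨(isTensorBound_minNorm (A := A) (B := B) t).1,
    fun H K _ _ _ _ _ _ π ρ x => ?_⟩
  have h := (isTensorBound_minNorm (A := A) (B := B) t).2 H K (π.comp f) (ρ.comp g) x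
  exact (congrArg (fun L => ‖L x‖) (tensorRep_comp f g π ρ t)).trans_le h

theorem continuous_preMap (f : A →⋆ₐ[ℂ] A') (g : B →⋆ₐ[ℂ] B') : Continuous (preMap f g) :=
  AddMonoidHomClass.continuous_of_bound (preMap f g) 1 fun t => by
    simpa using norm_preMap_le f g t

/-- The continuous extension of the algebraic tensor product of two ⋆-homomorphisms. -/
noncomputable def mapFun (f : A →⋆ₐ[ℂ] A') (g : B →⋆ₐ[ℂ] B') (x : MinTensor A B) :
    MinTensor A' B' :=
  Completion.map (preMap f g) x

theorem continuous_mapFun (f : A →⋆ₐ[ℂ] A') (g : B →⋆ₐ[ℂ] B') : Continuous (mapFun f g) :=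
  Completion.continuous_map

theorem mapFun_ofAlg (f : A →⋆ₐ[ℂ] A') (g : B →⋆ₐ[ℂ] B') (t : PreMinTensor A B) :
    mapFun f g (ofAlg t) = ofAlg (preMap f g t) :=
  Completion.map_coe (uniformContinuous_addMonoidHom_of_continuous (continuous_preMap f g)) t

theorem algebraMap_eq_ofAlg (z : ℂ) :
    algebraMap ℂ (MinTensor A B) z = ofAlg (algebraMap ℂ (PreMinTensor A B) z) := rfl

/-- The tensor product `f ⊗ g` of two ⋆-homomorphisms, as a ⋆-homomorphism between minimal tensor
products. -/
noncomputable def map (f : A →⋆ₐ[ℂ] A') (g : B →⋆ₐ[ℂ] B') :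
    MinTensor A B →⋆ₐ[ℂ] MinTensor A' B' where
  toFun := mapFun f g
  map_one' := by rw [← ofAlg_one, mapFun_ofAlg, map_one, ofAlg_one]
  map_mul' x y := by
    have hc := continuous_mapFun f g
    induction x, y using induction₂ with
    | hp => exact isClosed_eq (hc.comp continuous_mul)
              ((hc.comp continuous_fst).mul (hc.comp continuous_snd))
    | h s t => rw [← ofAlg_mul, mapFun_ofAlg, mapFun_ofAlg, mapFun_ofAlg, map_mul, ofAlg_mul]
  map_zero' := by
    have h0 : (0 : MinTensor A B) = ofAlg 0 := rfl
    rw [h0, mapFun_ofAlg, map_zero]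
    rfl
  map_add' x y := by
    have hc := continuous_mapFun f g
    induction x, y using induction₂ with
    | hp => exact isClosed_eq (hc.comp continuous_add)
              ((hc.comp continuous_fst).add (hc.comp continuous_snd))
    | h s t => rw [← ofAlg_add, mapFun_ofAlg, mapFun_ofAlg, mapFun_ofAlg, map_add, ofAlg_add]
  commutes' z := by
    rw [algebraMap_eq_ofAlg, mapFun_ofAlg, AlgHom.commutes, algebraMap_eq_ofAlg]
  map_star' x := by
    have hc := continuous_mapFun f g
    induction x using induction with
    | hp => exact isClosed_eq (hc.comp continuous_star') (continuous_star'.comp hc)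
    | h t => rw [star_ofAlg, mapFun_ofAlg, mapFun_ofAlg, star_ofAlg, preMap_star]

theorem map_tmul (f : A →⋆ₐ[ℂ] A') (g : B →⋆ₐ[ℂ] B') (a : A) (b : B) :
    map f g (tmul a b) = tmul (f a) (g b) :=
  mapFun_ofAlg f g _

end Map

end MinTensor

open MinTensor in
/-- A compact quantum group `G = (A, Φ)` with unital C⋆-algebra `A`: a coassociative unital
⋆-homomorphism `Φ : A → A ⊗ A` into the minimal tensor product such that `(A ⊗ 1)Φ(A)` and
`(1 ⊗ A)Φ(A)` span dense subspaces of `A ⊗ A`. -/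
structure CompactQuantumGroup (A : Type u) [CStarAlgebra A] where
  /-- `1 ≠ 0` in `A`. -/
  nontrivial : Nontrivial A
  /-- The comultiplication `Φ`. -/
  comul : A →⋆ₐ[ℂ] MinTensor A A
  /-- `(Φ ⊗ id)Φ = (id ⊗ Φ)Φ`, where `α` is the canonical identification of `(A ⊗ A) ⊗ A` with
  `A ⊗ (A ⊗ A)`; it is the only one with the given values on elementary tensors, as these span a
  dense subspace. -/
  coassoc : ∃ α : MinTensor (MinTensor A A) A ≃⋆ₐ[ℂ] MinTensor A (MinTensor A A),
    (∀ a b c, α (tmul (tmul a b) c) = tmul a (tmul b c)) ∧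
    ∀ a, α (map comul (StarAlgHom.id ℂ A) (comul a)) = map (StarAlgHom.id ℂ A) comul (comul a)
  dense_left :
    Dense (Submodule.span ℂ {x | ∃ a b, x = tmul a 1 * comul b} : Set (MinTensor A A))
  dense_right :
    Dense (Submodule.span ℂ {x | ∃ a b, x = tmul 1 a * comul b} : Set (MinTensor A A))

section Matrices

variable {A : Type u} [CStarAlgebra A] {l m n : Type*} [Fintype l] [Fintype m] [Fintype n]

/-- `T` intertwines `u` and `v`, that is, `(T ⊗ 1)u = v(T ⊗ 1)`. -/
def Intertwines (T : Matrix m n ℂ) (u : Matrix n n A) (v : Matrix m m A) : Prop :=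
  T.map (algebraMap ℂ A) * u = v * T.map (algebraMap ℂ A)

/-- Equivalence of representations: there is an invertible intertwiner. -/
def RepEquiv [DecidableEq m] [DecidableEq n] (u : Matrix n n A) (v : Matrix m m A) : Prop :=
  ∃ (T : Matrix m n ℂ) (S : Matrix n m ℂ), T * S = 1 ∧ S * T = 1 ∧ Intertwines T u v

/-- `u` is (equivalent to) a subrepresentation of `v`: there is an injective intertwiner. -/
def IsSubrep (u : Matrix n n A) (v : Matrix m m A) : Prop :=
  ∃ T : Matrix m n ℂ, Function.Injective T.mulVec ∧ Intertwines T u v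

/-- The subspace `W` of `ℂⁿ` is invariant under `u`, that is, `u(W ⊗ 1) ⊆ W ⊗ A`; equivalently, `W`
is invariant under all the operators `(id ⊗ φ)(u)` with `φ` a bounded functional on `A`. -/
def IsInvariant (u : Matrix n n A) (W : Submodule ℂ (n → ℂ)) : Prop :=
  ∀ φ : A →L[ℂ] ℂ, ∀ w ∈ W, (u.map φ).mulVec w ∈ W

/-- `u` acts on a nonzero space and has no invariant subspaces besides `0` and the whole space. -/
def IsIrreducible (u : Matrix n n A) : Prop :=
  Nonempty n ∧ ∀ W : Submodule ℂ (n → ℂ), IsInvariant u W → W = ⊥ ∨ W = ⊤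

/-- The conjugate representation, with matrix entries `(u i j)⋆`. -/
def conjMatrix (u : Matrix n n A) : Matrix n n A := u.map star

/-- The tensor product of representations, with matrix entries `u i j * v k l`. -/
def tensorMatrix (u : Matrix n n A) (v : Matrix m m A) : Matrix (n × m) (n × m) A :=
  Matrix.kroneckerMap (fun a b => a * b) u v

theorem RepEquiv.refl [DecidableEq n] (u : Matrix n n A) : RepEquiv u u :=
  ⟨1, 1, by simp, by simp, by simp [Intertwines, Matrix.map_one]⟩

theorem RepEquiv.symm [DecidableEq m] [DecidableEq n] {u : Matrix n n A} {v : Matrix m m A}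
    (h : RepEquiv u v) : RepEquiv v u := by
  obtain ⟨T, S, hTS, hST, h⟩ := h
  refine ⟨S, T, hST, hTS, ?_⟩
  have h1 : S.map (algebraMap ℂ A) * T.map (algebraMap ℂ A) = 1 := by
    rw [← Matrix.map_mul, hST, Matrix.map_one _ (map_zero _) (map_one _)]
  have h2 : T.map (algebraMap ℂ A) * S.map (algebraMap ℂ A) = 1 := by
    rw [← Matrix.map_mul, hTS, Matrix.map_one _ (map_zero _) (map_one _)]
  unfold Intertwines at h ⊢
  calc S.map (algebraMap ℂ A) * v
      = S.map (algebraMap ℂ A) * (v * T.map (algebraMap ℂ A)) * S.map (algebraMap ℂ A) := by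
        rw [Matrix.mul_assoc, Matrix.mul_assoc, h2, Matrix.mul_one]
    _ = u * S.map (algebraMap ℂ A) := by
        rw [← h, ← Matrix.mul_assoc, h1, Matrix.one_mul]

theorem RepEquiv.trans [DecidableEq l] [DecidableEq m] [DecidableEq n] {u : Matrix n n A}
    {v : Matrix m m A} {w : Matrix l l A} (h : RepEquiv u v) (h' : RepEquiv v w) :
    RepEquiv u w := by
  obtain ⟨T, S, hTS, hST, h⟩ := h
  obtain ⟨T', S', hTS', hST', h'⟩ := h'
  refine ⟨T' * T, S * S', ?_, ?_, ?_⟩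
  · rw [Matrix.mul_assoc, ← Matrix.mul_assoc T, hTS, Matrix.one_mul, hTS']
  · rw [Matrix.mul_assoc, ← Matrix.mul_assoc S', hST', Matrix.one_mul, hST]
  · unfold Intertwines at h h' ⊢
    rw [Matrix.map_mul, Matrix.mul_assoc, h, ← Matrix.mul_assoc, h', Matrix.mul_assoc]

end Matrices

namespace CompactQuantumGroup

variable {A : Type u} [CStarAlgebra A] (G : CompactQuantumGroup A)

/-- A finite dimensional unitary representation of `G`, in coordinates with respect to an
orthonormal basis: a unitary matrix `u` over `A` with `Φ(u i j) = ∑ k, u i k ⊗ u k j`. -/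
def IsRep {n : Type*} [Fintype n] [DecidableEq n] (u : Matrix n n A) : Prop :=
  u ∈ unitary (Matrix n n A) ∧
    ∀ i j, G.comul (u i j) = ∑ k, MinTensor.tmul (u i k) (u k j)

/-- An irreducible finite dimensional unitary representation of `G` on some `ℂⁿ`. -/
structure Irrep where
  /-- The dimension. -/
  dim : ℕ
  /-- The matrix. -/
  mat : Matrix (Fin dim) (Fin dim) A
  isRep : G.IsRep mat
  irreducible : IsIrreducible mat

/-- Equivalence of irreducible representations. -/
instance irrepSetoid : Setoid G.Irrep where
  r u v := RepEquiv u.mat v.mat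
  iseqv := ⟨fun u => .refl u.mat, .symm, .trans⟩

/-- The set `Ĝ` of equivalence classes of irreducible representations of `G`. -/
def Irr : Type u := Quotient G.irrepSetoid

variable {G}

/-- The equivalence class of an irreducible representation. -/
def Irrep.cls (u : G.Irrep) : G.Irr := Quotient.mk _ u

variable (G)

theorem tmul_one_one : MinTensor.tmul (1 : A) (1 : A) = 1 := rfl

/-- The trivial representation. -/
def trivialIrrep : G.Irrep where
  dim := 1
  mat := 1
  isRep := by
    refine ⟨one_mem _, fun i j => ?_⟩
    rw [Subsingleton.elim i 0, Subsingleton.elim j 0]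
    simp [tmul_one_one]
  irreducible := by
    refine ⟨⟨0⟩, fun W _ => ?_⟩
    by_cases h : W = ⊥
    · exact Or.inl h
    · refine Or.inr ?_
      obtain ⟨w, hw, hw0⟩ := Submodule.exists_mem_ne_zero_of_ne_bot h
      have h0 : w 0 ≠ 0 := fun h0 => hw0 (by ext i; fin_cases i; exact h0)
      refine (Submodule.eq_top_iff').2 fun x => ?_
      have : x = (x 0 / w 0) • w := by
        ext i; fin_cases i; simp [h0]
      rw [this]
      exact W.smul_mem _ hw

/-- The class of the trivial representation. -/
def trivialClass : G.Irr := G.trivialIrrep.cls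

/-- The fusion product `a × b`: the set of classes of the irreducible representations that are
subrepresentations of `uᵃ ⊗ uᵇ`. -/
def fusion (a b : G.Irr) : Set G.Irr :=
  {c | ∃ u v w : G.Irrep, u.cls = a ∧ v.cls = b ∧ w.cls = c ∧
    IsSubrep w.mat (tensorMatrix u.mat v.mat)}

/-- `b` is the conjugate `ā` of the class `a`: the unitary representations in `b` are equivalent to
the conjugates of the representations in `a`. -/
def IsConj (a b : G.Irr) : Prop :=
  ∃ u v : G.Irrep, u.cls = a ∧ v.cls = b ∧ RepEquiv v.mat (conjMatrix u.mat)

/-- The product of subsets of `Ĝ`: the union of all `a × b` with `a ∈ S` and `b ∈ T`. -/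
def setProd (S T : Set G.Irr) : Set G.Irr := {c | ∃ a ∈ S, ∃ b ∈ T, c ∈ G.fusion a b}

/-- A subobject of `Ĝ`: a subset that contains the trivial class and is closed under fusion products
and conjugation. -/
structure IsSubobject (S : Set G.Irr) : Prop where
  one_mem : G.trivialClass ∈ S
  mul_mem : ∀ a ∈ S, ∀ b ∈ S, G.fusion a b ⊆ S
  conj_mem : ∀ a ∈ S, ∀ b, G.IsConj a b → b ∈ S

/-- The relation `a ∼ b` defined by the subset `S` of `Ĝ`: `a × b̄` meets `S`. -/
def cosetRel (S : Set G.Irr) (a b : G.Irr) : Prop :=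
  ∃ b', G.IsConj b b' ∧ (G.fusion a b' ∩ S).Nonempty

/-- The set of `S`-cosets, the classes of the relation `∼`. -/
def Coset (S : Set G.Irr) : Type u := {C : Set G.Irr // ∃ b, C = {a | G.cosetRel S a b}}

variable {G}

/-- The subset of `Ĝ` underlying a coset. -/
def Coset.carrier {S : Set G.Irr} (C : G.Coset S) : Set G.Irr := C.1

/-- The coset `E` is the product of the cosets `C` and `D` as subsets of `Ĝ`. -/
def Coset.IsProduct {S : Set G.Irr} (C D E : G.Coset S) : Prop :=
  E.carrier = G.setProd C.carrier D.carrier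

/-- The multiplication of the group structure `g` on the set of cosets is the product of cosets as
subsets of `Ĝ`. -/
def IsCosetGroup {S : Set G.Irr} (g : Group (G.Coset S)) : Prop :=
  ∀ C D : G.Coset S, Coset.IsProduct C D (g.mul C D)

variable (G)

/-- A central subobject of `Ĝ`: a subobject whose cosets form a group under the product of
subsets. -/
def IsCentralSubobject (S : Set G.Irr) : Prop :=
  G.IsSubobject S ∧ ∃ g : Group (G.Coset S), IsCosetGroup g

/-- The center subobject of `Ĝ`: the intersection of all central subobjects. -/
def centerSubobject : Set G.Irr := ⋂₀ {S | G.IsCentralSubobject S}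

/-- The center of `G`, as a discrete group: the cosets of the center subobject, under the product of
cosets. -/
abbrev Center : Type u := G.Coset G.centerSubobject

end CompactQuantumGroup

/-- A bijection `p : Ĝ₁ → Ĝ₂` that identifies the fusion rules: `p(a × b) = p(a) × p(b)`. -/
def IsFusionBijection {A : Type u} {B : Type v} [CStarAlgebra A] [CStarAlgebra B]
    (G₁ : CompactQuantumGroup A) (G₂ : CompactQuantumGroup B) (p : G₁.Irr ≃ G₂.Irr) : Prop :=
  ∀ a b, p '' G₁.fusion a b = G₂.fusion (p a) (p b)

end CQG

/-!
The fusion rules determine the trivial class and the conjugation, and the notions in the theorem are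
defined from these and the fusion product alone.

Schur's lemma (`CQG.Intertwines.repEquiv`) gives `a × 1 = {a} = 1 × a`, so the trivial class is the
unique unit of the fusion product and is preserved by `p`. An invariant vector of `u ⊗ v`, read as a
scalar matrix `T` with `u T vᵗ = T`, is the same as an intertwiner `Tᵗ` from the conjugate of `u` to
`v`, because `u` is unitary. As the conjugate of an irreducible representation is irreducible,
Schur's lemma shows that `b` is the conjugate of `a` exactly when `a × b` contains the trivial class
(`CQG.CompactQuantumGroup.isConj_iff_mem_fusion`), so that `p` preserves conjugation as well. Hence `p` carries
subobjects, cosets, products of cosets and group structures on cosets of `Ĝ₁` to those of `Ĝ₂`,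
and so does its inverse.
-/

namespace CQG

/-! ### Intertwiners and Schur's lemma -/

section Schur

variable {A : Type u} [CStarAlgebra A] {l m n : Type*} [Fintype l] [Fintype m] [Fintype n]

theorem intertwines_iff {T : Matrix m n ℂ} {u : Matrix n n A} {v : Matrix m m A} :
    Intertwines T u v ↔ ∀ i j, ∑ k, T i k • u k j = ∑ k, T k j • v i k := by
  simp only [Intertwines, ← Matrix.ext_iff, Matrix.mul_apply, Matrix.map_apply, Algebra.smul_def,
    Algebra.commutes]

theorem Intertwines.comp {S : Matrix l m ℂ} {T : Matrix m n ℂ} {u : Matrix n n A}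
    {v : Matrix m m A} {w : Matrix l l A} (hS : Intertwines S v w) (hT : Intertwines T u v) :
    Intertwines (S * T) u w := by
  unfold Intertwines at *
  rw [Matrix.map_mul, Matrix.mul_assoc, hT, ← Matrix.mul_assoc, hS, Matrix.mul_assoc]

theorem Intertwines.mul_map {T : Matrix m n ℂ} {u : Matrix n n A} {v : Matrix m m A}
    (h : Intertwines T u v) (φ : A →L[ℂ] ℂ) : T * u.map φ = v.map φ * T := by
  ext i j
  have := congrArg φ (intertwines_iff.1 h i j)
  simp only [map_sum, map_smul, smul_eq_mul] at this
  simp only [Matrix.mul_apply, Matrix.map_apply, this, mul_comm]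

theorem Intertwines.isInvariant_ker {T : Matrix m n ℂ} {u : Matrix n n A} {v : Matrix m m A}
    (h : Intertwines T u v) : IsInvariant u (LinearMap.ker T.mulVecLin) := by
  intro φ w hw
  rw [LinearMap.mem_ker, Matrix.mulVecLin_apply] at *
  rw [Matrix.mulVec_mulVec, h.mul_map, ← Matrix.mulVec_mulVec, hw, Matrix.mulVec_zero]

theorem Intertwines.isInvariant_range {T : Matrix m n ℂ} {u : Matrix n n A} {v : Matrix m m A}
    (h : Intertwines T u v) : IsInvariant v (LinearMap.range T.mulVecLin) := by
  rintro φ _ ⟨w, rfl⟩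
  refine ⟨(u.map φ).mulVec w, ?_⟩
  simp only [Matrix.mulVecLin_apply, Matrix.mulVec_mulVec, h.mul_map]

/-- Schur's lemma: a nonzero intertwiner between irreducible representations is invertible. -/
theorem Intertwines.repEquiv [DecidableEq m] [DecidableEq n] {T : Matrix m n ℂ}
    {u : Matrix n n A} {v : Matrix m m A} (h : Intertwines T u v) (hu : IsIrreducible u)
    (hv : IsIrreducible v) (hT : T ≠ 0) : RepEquiv u v := by
  have hT' : T.mulVecLin ≠ 0 := by
    rw [← Matrix.toLin'_apply']
    simpa using hT
  have hker : LinearMap.ker T.mulVecLin = ⊥ :=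
    (hu.2 _ h.isInvariant_ker).resolve_right fun h' => hT' (LinearMap.ker_eq_top.1 h')
  have hrange : LinearMap.range T.mulVecLin = ⊤ :=
    (hv.2 _ h.isInvariant_range).resolve_left fun h' => hT' (LinearMap.range_eq_bot.1 h')
  let e := LinearEquiv.ofBijective T.mulVecLin
    ⟨LinearMap.ker_eq_bot.1 hker, LinearMap.range_eq_top.1 hrange⟩
  have he : Matrix.toLin' T = e.toLinearMap := rfl
  refine ⟨T, LinearMap.toMatrix' e.symm.toLinearMap, ?_, ?_, h⟩
  · apply Matrix.toLin'.injective
    rw [Matrix.toLin'_mul, Matrix.toLin'_toMatrix', he, Matrix.toLin'_one]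
    ext1; simp
  · apply Matrix.toLin'.injective
    rw [Matrix.toLin'_mul, Matrix.toLin'_toMatrix', he, Matrix.toLin'_one]
    ext1; simp

theorem injective_mulVec_of_mul_eq_one [DecidableEq n] {T : Matrix m n ℂ} {S : Matrix n m ℂ}
    (h : S * T = 1) : Function.Injective T.mulVec := fun x y hxy => by
  simpa [Matrix.mulVec_mulVec, h] using congrArg S.mulVec hxy

theorem IsSubrep.repEquiv [DecidableEq m] [DecidableEq n] {u : Matrix n n A} {v : Matrix m m A}
    (h : IsSubrep u v) (hu : IsIrreducible u) (hv : IsIrreducible v) : RepEquiv u v := by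
  obtain ⟨T, hT, h⟩ := h
  refine h.repEquiv hu hv ?_
  rintro rfl
  have := hu.1
  exact one_ne_zero (hT (a₁ := (1 : n → ℂ)) (a₂ := 0) (by simp))

theorem RepEquiv.isSubrep [DecidableEq m] [DecidableEq n] {u : Matrix n n A} {v : Matrix m m A}
    (h : RepEquiv u v) : IsSubrep u v := by
  obtain ⟨T, S, -, hST, h⟩ := h
  exact ⟨T, injective_mulVec_of_mul_eq_one hST, h⟩

theorem IsSubrep.trans {u : Matrix n n A} {v : Matrix m m A} {w : Matrix l l A}
    (h : IsSubrep u v) (h' : IsSubrep v w) : IsSubrep u w := by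
  obtain ⟨T, hT, h⟩ := h
  obtain ⟨S, hS, h'⟩ := h'
  refine ⟨S * T, fun x y hxy => hT (hS ?_), h'.comp h⟩
  simpa only [Matrix.mulVec_mulVec] using hxy

/-! ### Tensor products and conjugates -/

theorem Intertwines.tensor {l' : Type*} [Fintype l'] {S : Matrix m n ℂ} {T : Matrix l l' ℂ}
    {u : Matrix n n A} {v : Matrix m m A} {u' : Matrix l' l' A} {v' : Matrix l l A}
    (hS : Intertwines S u v) (hT : Intertwines T u' v') :
    Intertwines (Matrix.kroneckerMap (· * ·) S T) (tensorMatrix u u') (tensorMatrix v v') := by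
  rw [intertwines_iff] at *
  rintro ⟨i, i'⟩ ⟨j, j'⟩
  have key := congrArg₂ (· * ·) (hS i j) (hT i' j')
  simp only [Finset.sum_mul_sum, smul_mul_smul_comm] at key
  simpa only [Fintype.sum_prod_type, Matrix.kroneckerMap_apply, tensorMatrix] using key

theorem RepEquiv.tensor {l' : Type*} [Fintype l'] [DecidableEq l] [DecidableEq l']
    [DecidableEq m] [DecidableEq n]
    {u : Matrix n n A} {v : Matrix m m A} {u' : Matrix l' l' A} {v' : Matrix l l A}
    (h : RepEquiv u v) (h' : RepEquiv u' v') :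
    RepEquiv (tensorMatrix u u') (tensorMatrix v v') := by
  obtain ⟨T, S, hTS, hST, h⟩ := h
  obtain ⟨T', S', hTS', hST', h'⟩ := h'
  exact ⟨_, Matrix.kroneckerMap (· * ·) S S',
    by rw [← Matrix.mul_kronecker_mul, hTS, hTS', Matrix.one_kronecker_one],
    by rw [← Matrix.mul_kronecker_mul, hST, hST', Matrix.one_kronecker_one], h.tensor h'⟩

theorem repEquiv_tensor_one [DecidableEq n] (u : Matrix n n A) :
    RepEquiv (tensorMatrix u (1 : Matrix (Fin 1) (Fin 1) A)) u := by
  refine ⟨.of fun i k => if i = k.1 then 1 else 0, .of fun k i => if i = k.1 then 1 else 0,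
    ?_, ?_, intertwines_iff.2 ?_⟩
  · ext i j
    simp [Matrix.mul_apply, Fintype.sum_prod_type, Matrix.one_apply,
      -Finset.sum_boole]
  · ext ⟨i, i'⟩ ⟨j, j'⟩
    simp [Matrix.mul_apply, Matrix.one_apply, Subsingleton.elim i' j', eq_comm]
  · rintro i ⟨j, j'⟩
    simp [Fintype.sum_prod_type, tensorMatrix, Subsingleton.elim j' 0]

theorem repEquiv_one_tensor [DecidableEq n] (u : Matrix n n A) :
    RepEquiv (tensorMatrix (1 : Matrix (Fin 1) (Fin 1) A) u) u := by
  refine ⟨.of fun i k => if i = k.2 then 1 else 0, .of fun k i => if i = k.2 then 1 else 0,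
    ?_, ?_, intertwines_iff.2 ?_⟩
  · ext i j
    simp [Matrix.mul_apply, Fintype.sum_prod_type, Matrix.one_apply,
      -Finset.sum_boole]
  · ext ⟨i, i'⟩ ⟨j, j'⟩
    simp [Matrix.mul_apply, Matrix.one_apply, Subsingleton.elim i j, eq_comm]
  · rintro i ⟨j, j'⟩
    obtain rfl := Subsingleton.elim j 0
    simp [Fintype.sum_prod_type, tensorMatrix]

/-- The bounded functional `a ↦ conj (φ (a⋆))`. -/
noncomputable def conjFunctional (φ : A →L[ℂ] ℂ) : A →L[ℂ] ℂ where
  toFun a := star (φ (star a))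
  map_add' a b := by simp
  map_smul' z a := by simp
  cont := by fun_prop

/-- A subspace is invariant under the conjugate of `u` if and only if its complex conjugate is
invariant under `u`. -/
theorem IsIrreducible.conjMatrix {u : Matrix n n A} (hu : IsIrreducible u) :
    IsIrreducible (conjMatrix u) := by
  refine ⟨hu.1, fun W hW => ?_⟩
  let W' : Submodule ℂ (n → ℂ) :=
    { carrier := {x | star x ∈ W}
      add_mem' := fun {x y} hx hy => by simpa using W.add_mem hx hy
      zero_mem' := by simp
      smul_mem' := fun z x hx => by simpa using W.smul_mem (star z) hx }
  have hW' : IsInvariant u W' := by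
    intro φ w hw
    have h : star ((u.map φ).mulVec w) =
        ((CQG.conjMatrix u).map (conjFunctional φ)).mulVec (star w) := by
      ext i
      simp [Matrix.mulVec, dotProduct, CQG.conjMatrix, conjFunctional]
    change star ((u.map φ).mulVec w) ∈ W
    rw [h]
    exact hW (conjFunctional φ) (star w) hw
  rcases hu.2 W' hW' with h | h
  · refine Or.inl ((Submodule.eq_bot_iff _).2 fun x hx => ?_)
    have hx' : star x ∈ W' := by simpa [W'] using hx
    rw [h] at hx'
    simpa using hx'
  · refine Or.inr ((Submodule.eq_top_iff').2 fun x => ?_)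
    have hx' : star x ∈ W' := by rw [h]; trivial
    simpa [W'] using hx'

/-- For unitary `u`, the invariant vectors of `u ⊗ v` are the intertwiners from the conjugate of `u`
to `v`: the equations `u T vᵗ = T` and `T vᵗ = u⋆ T` are equivalent. -/
theorem intertwines_one_tensor_iff [DecidableEq n] {u : Matrix n n A} {v : Matrix m m A}
    (hu : u ∈ unitary (Matrix n n A)) (t : Matrix (n × m) (Fin 1) ℂ) :
    Intertwines t 1 (tensorMatrix u v) ↔
      Intertwines (.of fun j i => t (i, j) 0) (conjMatrix u) v := by
  let t' : Matrix n m A := .of fun i j => algebraMap ℂ A (t (i, j) 0)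
  have h1 : Intertwines t 1 (tensorMatrix u v) ↔ t' = u * (t' * v.transpose) := by
    rw [intertwines_iff, ← Matrix.ext_iff, Prod.forall]
    refine forall₂_congr fun i j => ?_
    simp [t', Matrix.mul_apply, Fintype.sum_prod_type, tensorMatrix, Finset.mul_sum,
      Algebra.algebraMap_eq_smul_one]
  have h2 : Intertwines (.of fun j i => t (i, j) 0) (conjMatrix u) v ↔
      star u * t' = t' * v.transpose := by
    rw [intertwines_iff, ← Matrix.ext_iff, forall_comm]
    refine forall₂_congr fun i j => ?_
    simp [t', Matrix.mul_apply, conjMatrix, Matrix.star_apply, Algebra.smul_def,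
      Algebra.commutes]
  rw [h1, h2]
  constructor
  · intro h
    calc star u * t' = star u * (u * (t' * v.transpose)) := by rw [← h]
      _ = t' * v.transpose := by
        rw [← Matrix.mul_assoc, Unitary.star_mul_self_of_mem hu, Matrix.one_mul]
  · intro h
    rw [← h, ← Matrix.mul_assoc, Unitary.mul_star_self_of_mem hu, Matrix.one_mul]

theorem isSubrep_one_iff {w : Matrix n n A} :
    IsSubrep (1 : Matrix (Fin 1) (Fin 1) A) w ↔
      ∃ t : Matrix n (Fin 1) ℂ, t ≠ 0 ∧ Intertwines t 1 w := by
  refine exists_congr fun t => and_congr_left fun _ => ⟨?_, fun ht x y hxy => ?_⟩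
  · rintro ht rfl
    exact one_ne_zero (ht (a₁ := (1 : Fin 1 → ℂ)) (a₂ := 0) (by simp))
  · obtain ⟨k, hk⟩ : ∃ k, t k 0 ≠ 0 := by
      by_contra! h0
      exact ht (by ext k j; rw [Subsingleton.elim j 0]; exact h0 k)
    ext i
    rw [Subsingleton.elim i 0]
    exact mul_left_cancel₀ hk (by simpa [Matrix.mulVec, dotProduct] using congrFun hxy k)

/-- For irreducible `u` and `v` with `u` unitary, the trivial representation occurs in `u ⊗ v` if
and only if `v` is equivalent to the conjugate of `u`. -/
theorem isSubrep_one_tensor_iff [DecidableEq m] [DecidableEq n] {u : Matrix n n A}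
    {v : Matrix m m A} (hu : u ∈ unitary (Matrix n n A)) (hu' : IsIrreducible u)
    (hv : IsIrreducible v) :
    IsSubrep (1 : Matrix (Fin 1) (Fin 1) A) (tensorMatrix u v) ↔ RepEquiv (conjMatrix u) v := by
  rw [isSubrep_one_iff]
  constructor
  · rintro ⟨t, ht, h⟩
    refine ((intertwines_one_tensor_iff hu t).1 h).repEquiv hu'.conjMatrix hv fun h0 => ht ?_
    ext ⟨i, j⟩ k
    rw [Subsingleton.elim k 0]
    exact congrFun (congrFun h0 j) i
  · rintro ⟨T, S, -, hST, h⟩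
    refine ⟨.of fun k _ => T k.2 k.1, fun h0 => ?_, (intertwines_one_tensor_iff hu _).2 h⟩
    have hT : T = 0 := by
      ext j i
      exact congrFun (congrFun h0 (i, j)) 0
    have := hu'.1
    rw [hT, Matrix.mul_zero] at hST
    exact zero_ne_one hST

end Schur

namespace CompactQuantumGroup

/-! ### Unit and conjugation in terms of the fusion product -/

section Fusion

variable {A : Type u} [CStarAlgebra A] {G : CompactQuantumGroup A}

theorem Irrep.cls_eq_iff {u v : G.Irrep} : u.cls = v.cls ↔ RepEquiv u.mat v.mat :=
  Quotient.eq (r := G.irrepSetoid)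

theorem Irr.exists_rep (a : G.Irr) : ∃ u : G.Irrep, u.cls = a := Quotient.exists_rep a

theorem fusion_cls (u v w : G.Irrep) :
    w.cls ∈ G.fusion u.cls v.cls ↔ IsSubrep w.mat (tensorMatrix u.mat v.mat) := by
  refine ⟨?_, fun h => ⟨u, v, w, rfl, rfl, rfl, h⟩⟩
  rintro ⟨u', v', w', hu, hv, hw, h⟩
  rw [Irrep.cls_eq_iff] at hu hv hw
  exact (hw.symm.isSubrep.trans h).trans (hu.tensor hv).isSubrep

theorem fusion_trivialClass (a : G.Irr) : G.fusion a G.trivialClass = {a} := by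
  obtain ⟨u, rfl⟩ := a.exists_rep
  ext c
  obtain ⟨w, rfl⟩ := c.exists_rep
  rw [trivialClass, fusion_cls, Set.mem_singleton_iff, Irrep.cls_eq_iff]
  have h := repEquiv_tensor_one u.mat
  exact ⟨fun h' => (h'.trans h.isSubrep).repEquiv w.irreducible u.irreducible,
    fun h' => h'.isSubrep.trans h.symm.isSubrep⟩

theorem trivialClass_fusion (a : G.Irr) : G.fusion G.trivialClass a = {a} := by
  obtain ⟨u, rfl⟩ := a.exists_rep
  ext c
  obtain ⟨w, rfl⟩ := c.exists_rep
  rw [trivialClass, fusion_cls, Set.mem_singleton_iff, Irrep.cls_eq_iff]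
  have h := repEquiv_one_tensor u.mat
  exact ⟨fun h' => (h'.trans h.isSubrep).repEquiv w.irreducible u.irreducible,
    fun h' => h'.isSubrep.trans h.symm.isSubrep⟩

/-- The class `b` is the conjugate of `a` if and only if the trivial class occurs in `a × b`. -/
theorem isConj_iff_mem_fusion {a b : G.Irr} :
    G.IsConj a b ↔ G.trivialClass ∈ G.fusion a b := by
  have key (u v : G.Irrep) :
      RepEquiv v.mat (conjMatrix u.mat) ↔ G.trivialClass ∈ G.fusion u.cls v.cls :=
    ⟨fun h => (fusion_cls u v G.trivialIrrep).2
        ((isSubrep_one_tensor_iff u.isRep.1 u.irreducible v.irreducible).2 h.symm),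
      fun h => ((isSubrep_one_tensor_iff u.isRep.1 u.irreducible v.irreducible).1
        ((fusion_cls u v G.trivialIrrep).1 h)).symm⟩
  constructor
  · rintro ⟨u, v, rfl, rfl, h⟩
    exact (key u v).1 h
  · obtain ⟨u, rfl⟩ := a.exists_rep
    obtain ⟨v, rfl⟩ := b.exists_rep
    exact fun h => ⟨u, v, rfl, rfl, (key u v).2 h⟩

end Fusion

end CompactQuantumGroup

/-! ### Transport along a fusion bijection -/

namespace IsFusionBijection

open CompactQuantumGroup

variable {A : Type u} {B : Type v} [CStarAlgebra A] [CStarAlgebra B]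
  {G₁ : CompactQuantumGroup A} {G₂ : CompactQuantumGroup B} {p : G₁.Irr ≃ G₂.Irr}

theorem symm (hp : IsFusionBijection G₁ G₂ p) : IsFusionBijection G₂ G₁ p.symm := fun a b => by
  apply p.injective.image_injective
  rw [hp, p.apply_symm_apply, p.apply_symm_apply, p.image_symm_image]

theorem mem_fusion (hp : IsFusionBijection G₁ G₂ p) {a b c : G₁.Irr} :
    p c ∈ G₂.fusion (p a) (p b) ↔ c ∈ G₁.fusion a b := by
  rw [← hp, p.injective.mem_set_image]

theorem map_trivialClass (hp : IsFusionBijection G₁ G₂ p) :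
    p G₁.trivialClass = G₂.trivialClass := by
  -- `p 1` is a right unit, so `1 × p 1` is both `{1}` and `{p 1}`.
  have h := hp (p.symm G₂.trivialClass) G₁.trivialClass
  rw [fusion_trivialClass, Set.image_singleton, p.apply_symm_apply, trivialClass_fusion] at h
  exact (Set.singleton_injective h).symm

theorem isConj (hp : IsFusionBijection G₁ G₂ p) {a b : G₁.Irr} :
    G₂.IsConj (p a) (p b) ↔ G₁.IsConj a b := by
  rw [isConj_iff_mem_fusion, isConj_iff_mem_fusion, ← hp.map_trivialClass, hp.mem_fusion]

theorem image_setProd (hp : IsFusionBijection G₁ G₂ p) (S T : Set G₁.Irr) :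
    p '' G₁.setProd S T = G₂.setProd (p '' S) (p '' T) := by
  ext c
  obtain ⟨c, rfl⟩ := p.surjective c
  simp only [p.injective.mem_set_image, setProd, Set.mem_ofPred_eq, Set.exists_mem_image,
    hp.mem_fusion]

theorem isSubobject_image (hp : IsFusionBijection G₁ G₂ p) {S : Set G₁.Irr}
    (h : G₁.IsSubobject S) : G₂.IsSubobject (p '' S) where
  one_mem := ⟨_, h.one_mem, hp.map_trivialClass⟩
  mul_mem := by
    rintro _ ⟨a, ha, rfl⟩ _ ⟨b, hb, rfl⟩
    rw [← hp]
    exact Set.image_mono (h.mul_mem a ha b hb)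
  conj_mem := by
    rintro _ ⟨a, ha, rfl⟩ b hb
    obtain ⟨b, rfl⟩ := p.surjective b
    exact ⟨b, h.conj_mem a ha b (hp.isConj.1 hb), rfl⟩

theorem cosetRel_image (hp : IsFusionBijection G₁ G₂ p) {S : Set G₁.Irr} {a b : G₁.Irr} :
    G₂.cosetRel (p '' S) (p a) (p b) ↔ G₁.cosetRel S a b := by
  simp only [cosetRel, ← p.exists_congr_right, hp.isConj, ← hp _ _,
    ← Set.image_inter p.injective, Set.image_nonempty]

theorem image_coset (hp : IsFusionBijection G₁ G₂ p) (S : Set G₁.Irr) (b : G₁.Irr) :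
    p '' {a | G₁.cosetRel S a b} = {a | G₂.cosetRel (p '' S) a (p b)} := by
  ext a
  obtain ⟨a, rfl⟩ := p.surjective a
  simp only [p.injective.mem_set_image, Set.mem_ofPred_eq, hp.cosetRel_image]

/-- The bijection `C ↦ p(C)` from the `S`-cosets to the `T`-cosets, for `T = p(S)`. -/
noncomputable def cosetEquiv (hp : IsFusionBijection G₁ G₂ p) {S : Set G₁.Irr} {T : Set G₂.Irr}
    (hT : p '' S = T) : G₁.Coset S ≃ G₂.Coset T :=
  (Equiv.Set.congr p).subtypeEquiv fun C => by
    subst hT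
    constructor
    · rintro ⟨b, rfl⟩
      exact ⟨p b, hp.image_coset S b⟩
    · rintro ⟨b, hb⟩
      obtain ⟨b, rfl⟩ := p.surjective b
      exact ⟨b, p.injective.image_injective (hb.trans (hp.image_coset S b).symm)⟩

variable {S : Set G₁.Irr} {T : Set G₂.Irr}

theorem carrier_cosetEquiv (hp : IsFusionBijection G₁ G₂ p) (hT : p '' S = T) (C : G₁.Coset S) :
    (hp.cosetEquiv hT C).carrier = p '' C.carrier := rfl

theorem isProduct_cosetEquiv (hp : IsFusionBijection G₁ G₂ p) (hT : p '' S = T)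
    (C D E : G₁.Coset S) :
    Coset.IsProduct C D E ↔
      Coset.IsProduct (hp.cosetEquiv hT C) (hp.cosetEquiv hT D) (hp.cosetEquiv hT E) := by
  simp only [Coset.IsProduct, hp.carrier_cosetEquiv, ← hp.image_setProd,
    p.injective.image_injective.eq_iff]

theorem isCentralSubobject_image (hp : IsFusionBijection G₁ G₂ p)
    (h : G₁.IsCentralSubobject S) : G₂.IsCentralSubobject (p '' S) := by
  obtain ⟨hS, g, hg⟩ := h
  let e := hp.cosetEquiv (S := S) rfl
  refine ⟨hp.isSubobject_image hS, e.symm.group, fun C D => ?_⟩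
  have := (hp.isProduct_cosetEquiv rfl _ _ _).1 (hg (e.symm C) (e.symm D))
  change Coset.IsProduct (e _) (e _) _ at this
  rwa [e.apply_symm_apply, e.apply_symm_apply] at this

theorem isCentralSubobject_image_iff (hp : IsFusionBijection G₁ G₂ p) (S : Set G₁.Irr) :
    G₁.IsCentralSubobject S ↔ G₂.IsCentralSubobject (p '' S) := by
  refine ⟨hp.isCentralSubobject_image, fun h => ?_⟩
  simpa using hp.symm.isCentralSubobject_image h

theorem image_centerSubobject (hp : IsFusionBijection G₁ G₂ p) :
    p '' G₁.centerSubobject = G₂.centerSubobject := by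
  ext a
  obtain ⟨a, rfl⟩ := p.surjective a
  simp only [p.injective.mem_set_image, centerSubobject, Set.mem_sInter, Set.mem_ofPred_eq]
  constructor
  · intro h T hT
    obtain ⟨S, rfl⟩ := p.surjective.image_surjective T
    exact Set.mem_image_of_mem p (h S ((hp.isCentralSubobject_image_iff S).2 hT))
  · intro h S hS
    exact p.injective.mem_set_image.1 (h _ (hp.isCentralSubobject_image hS))

end IsFusionBijection

end CQG

theorem theorem7p1 {A : Type u} {B : Type v} [CStarAlgebra A] [CStarAlgebra B]
    (G₁ : CQG.CompactQuantumGroup A) (G₂ : CQG.CompactQuantumGroup B)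
    (p : G₁.Irr ≃ G₂.Irr) (hp : CQG.IsFusionBijection G₁ G₂ p) :
    (∀ S : Set G₁.Irr, G₁.IsCentralSubobject S ↔ G₂.IsCentralSubobject (p '' S)) ∧
    p '' G₁.centerSubobject = G₂.centerSubobject ∧
    ∃ e : G₁.Center ≃ G₂.Center,
      (∀ C : G₁.Center, (e C).carrier = p '' C.carrier) ∧
      (∀ C D E : G₁.Center,
        CQG.CompactQuantumGroup.Coset.IsProduct C D E ↔
          CQG.CompactQuantumGroup.Coset.IsProduct (e C) (e D) (e E)) ∧
      (∀ (g₁ : Group G₁.Center) (g₂ : Group G₂.Center),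
        CQG.CompactQuantumGroup.IsCosetGroup g₁ → CQG.CompactQuantumGroup.IsCosetGroup g₂ →
          ∃ φ : G₁.Center ≃* G₂.Center, ∀ C, φ C = e C) := by
  have hc := hp.image_centerSubobject
  refine ⟨hp.isCentralSubobject_image_iff, hc, hp.cosetEquiv hc, hp.carrier_cosetEquiv hc,
    hp.isProduct_cosetEquiv hc, fun g₁ g₂ h₁ h₂ =>
      ⟨{ hp.cosetEquiv hc with map_mul' := fun C D => Subtype.ext ?_ }, fun C => rfl⟩⟩
  exact ((hp.isProduct_cosetEquiv hc _ _ _).1 (h₁ C D)).trans (h₂ _ _).symm
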